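/- Let $\mathbb F$ be a field of characteristic $2$ over which every quadratic and every cubic polynomial has a root. For a two-dimensional algebra with basis $e_1,e_2$ over $\mathbb F$ (not assumed associative, commutative or unital) write its matrix of structure constants as $\begin{pmatrix}\alpha_1&\alpha_2&\alpha_3&\alpha_4\\ \beta_1&\beta_2&\beta_3&\beta_4\end{pmatrix}$, where $e_1e_1=\alpha_1e_1+\beta_1e_2$, $e_1e_2=\alpha_2e_1+\beta_2e_2$, $e_2e_1=\alpha_3e_1+\beta_3e_2$, $e_2e_2=\alpha_4e_1+\beta_4e_2$. A nontrivial subalgebra means a one-dimensional subalgebra. The canonical algebras are, with parameters in $\mathbb F$, $A_{1,2}(\alpha_1,\alpha_2,\alpha_4,\beta_1)=\begin{pmatrix}\alpha_1&\alpha_2&\alpha_2+1&\alpha_4\\ \beta_1&-\alpha_1&-\alpha_1+1&-\alpha_2\end{pmatrix}$, $A_{2,2}(\alpha_1,\beta_1,\beta_2)=\begin{pmatrix}\alpha_1&0&0&1\\ \beta_1&\beta_2&1-\alpha_1&0\end{pmatrix}$, $A_{3,2}(\alpha_1,\beta_2)=\begin{pmatrix}\alpha_1&1&1&0\\ 0&\beta_2&1-\alpha_1&1\end{pmatrix}$,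 $A_{4,2}(\alpha_1,\beta_2)=\begin{pmatrix}\alpha_1&0&0&0\\ 0&\beta_2&1-\alpha_1&0\end{pmatrix}$, $A_{5,2}(\alpha_1)=\begin{pmatrix}\alpha_1&0&0&0\\ 1&1&1-\alpha_1&0\end{pmatrix}$, $A_{6,2}(\alpha_1,\beta_1)=\begin{pmatrix}\alpha_1&0&0&1\\ \beta_1&1-\alpha_1&\alpha_1&0\end{pmatrix}$, $A_{7,2}(\alpha_1)=\begin{pmatrix}\alpha_1&1&1&0\\ 0&1-\alpha_1&\alpha_1&1\end{pmatrix}$, $A_{8,2}(\alpha_1)=\begin{pmatrix}\alpha_1&0&0&0\\ 0&1-\alpha_1&\alpha_1&0\end{pmatrix}$, $A_{9,2}=\begin{pmatrix}1&0&0&0\\ 1&0&1&0\end{pmatrix}$, $A_{10,2}=\begin{pmatrix}0&1&1&0\\ 0&0&0&1\end{pmatrix}$, $A_{11,2}=\begin{pmatrix}1&1&1&0\\ 0&1&1&1\end{pmatrix}$, $A_{12,2}=\begin{pmatrix}0&0&0&0\\ 1&0&0&0\end{pmatrix}$. Consider the following four lists. List 1: $A_{1,2}(\alpha_1,\alpha_2,\alpha_4,\beta_1)$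 with $\alpha_4(\alpha_1+1)+(\alpha_2+1)^2=0$, $(\alpha_2+1)^3+\beta_1\alpha_4^2=0$ and $\alpha_4\ne0$; $A_{1,2}(1,1,0,\beta_1)$ with $\beta_1\neq0$; $A_{2,2}(\alpha_1,0,1)$; $A_{5,2}(\alpha_1)$; $A_{6,2}(1,0)$; $A_{9,2}$; $A_{12,2}$. List 2: $A_{1,2}(\alpha_1,\alpha_2,\alpha_4,\beta_1)$ with $\alpha_4\beta_1+(\alpha_1+1)(\alpha_2+1)=0$ and $\alpha_4(\alpha_4(\alpha_1+1)+(\alpha_2+1)^2)\neq0$; $A_{1,2}(1,\alpha_2,0,\beta_1)$ with $\alpha_2\ne1$; $A_{1,2}(\alpha_1,1,0,\beta_1)$ with $\alpha_1\neq1$; $A_{2,2}(\alpha_1,0,\beta_2)$ with $\beta_2\neq1$; $A_{3,2}(\alpha_1,1)$; $A_{4,2}(\alpha_1,\beta_2)$ with $\beta_2\ne1$; $A_{6,2}(\alpha_1,0)$ with $\alpha_1\neq1$; $A_{7,2}(1)$; $A_{8,2}(\alpha_1)$ with $\alpha_1\ne1$; $A_{10,2}$. List 3: $A_{1,2}(\alpha_1,\alpha_2,\alpha_4,\beta_1)$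 with $\alpha_4(\alpha_4\beta_1+(\alpha_1+1)(\alpha_2+1))\ne0$; $A_{1,2}(\alpha_1,\alpha_2,0,\beta_1)$ with $(\alpha_1+1)(\alpha_2+1)\neq0$; $A_{2,2}(\alpha_1,\beta_1,\beta_2)$ with $\beta_1\neq0$; $A_{3,2}(\alpha_1,\beta_2)$ with $\beta_2\neq1$; $A_{6,2}(\alpha_1,\beta_1)$ with $\beta_1\neq0$; $A_{7,2}(\alpha_1)$ with $\alpha_1\neq1$; $A_{11,2}$. List $\infty$: $A_{1,2}(1,1,0,0)$; $A_{4,2}(\alpha_1,1)$; $A_{8,2}(1)$. Then, for each $n\in\{1,2,3,\infty\}$: (a) a canonical algebra has exactly $n$ nontrivial subalgebras (infinitely many, if $n=\infty$) if and only if it belongs to List $n$; (b) every two-dimensional algebra over $\mathbb F$ with not identically zero product that has exactly $n$ (infinitely many, if $n=\infty$) nontrivial subalgebras is isomorphic to one and only one algebra in List $n$ (that is, for exactly one family and one choice of its parameters). -/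

import Mathlib

universe u v

/-- The two-dimensional (not necessarily associative, commutative or unital) algebra over `F` with
matrix of structure constants `M = (α₁ α₂ α₃ α₄; β₁ β₂ β₃ β₄)`. The underlying vector space is
`F²`, with standard basis `e₁, e₂`. -/
@[nolint unusedArguments]
def MSCAlgebra {F : Type u} (_M : Matrix (Fin 2) (Fin 4) F) : Type u := Fin 2 → F

namespace MSCAlgebra

variable {F : Type u} [Field F] (M : Matrix (Fin 2) (Fin 4) F)

instance : AddCommGroup (MSCAlgebra M) := inferInstanceAs (AddCommGroup (Fin 2 → F))

instance : Module F (MSCAlgebra M) := inferInstanceAs (Module F (Fin 2 → F))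

/-- The bilinear product determined by `e₁e₁ = α₁e₁ + β₁e₂`, `e₁e₂ = α₂e₁ + β₂e₂`,
`e₂e₁ = α₃e₁ + β₃e₂`, `e₂e₂ = α₄e₁ + β₄e₂`. -/
instance : Mul (MSCAlgebra M) where
  mul x y := fun i : Fin 2 =>
    M i 0 * (x 0 * y 0) + M i 1 * (x 0 * y 1) + M i 2 * (x 1 * y 0) + M i 3 * (x 1 * y 1)

variable {M}

theorem add_apply (x y : MSCAlgebra M) (i : Fin 2) : (x + y) i = x i + y i := rfl

theorem zero_apply (i : Fin 2) : (0 : MSCAlgebra M) i = 0 := rfl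

theorem smul_apply (r : F) (x : MSCAlgebra M) (i : Fin 2) : (r • x) i = r * x i := rfl

theorem mul_apply (x y : MSCAlgebra M) (i : Fin 2) : (x * y) i =
    M i 0 * (x 0 * y 0) + M i 1 * (x 0 * y 1) + M i 2 * (x 1 * y 0) + M i 3 * (x 1 * y 1) := rfl

instance : NonUnitalNonAssocRing (MSCAlgebra M) :=
  { (inferInstance : AddCommGroup (MSCAlgebra M)), (inferInstance : Mul (MSCAlgebra M)) with
    left_distrib := fun x y z => funext fun i => by
      simp only [mul_apply, add_apply]; ring
    right_distrib := fun x y z => funext fun i => by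
      simp only [mul_apply, add_apply]; ring
    zero_mul := fun x => funext fun i => by
      simp only [mul_apply, zero_apply]; ring
    mul_zero := fun x => funext fun i => by
      simp only [mul_apply, zero_apply]; ring }

instance : IsScalarTower F (MSCAlgebra M) (MSCAlgebra M) where
  smul_assoc r x y := funext fun i => by
    simp only [smul_eq_mul, mul_apply, smul_apply]; ring

instance : SMulCommClass F (MSCAlgebra M) (MSCAlgebra M) where
  smul_comm r x y := funext fun i => by
    simp only [smul_eq_mul, mul_apply, smul_apply]; ring

end MSCAlgebra

/-- Two algebras over `F` are isomorphic: there is an `F`-linear bijection preserving products. -/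
def AlgIsomorphic (F : Type u) [Field F] (A : Type v) [NonUnitalNonAssocRing A] [Module F A]
    (B : Type u) [NonUnitalNonAssocRing B] [Module F B] : Prop :=
  ∃ e : A ≃ₗ[F] B, ∀ x y : A, e (x * y) = e x * e y

/-- The nontrivial, that is one-dimensional, subalgebras of a two-dimensional algebra `A`. -/
def nontrivialSubalgebras (F : Type u) [Field F] (A : Type v) [NonUnitalNonAssocRing A]
    [Module F A] : Set (NonUnitalSubalgebra F A) :=
  {S | Module.finrank F S.toSubmodule = 1}

/-- The members of the twelve canonical families in characteristic two: a family together with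
values of its parameters. -/
inductive Canonical2 (F : Type u) : Type u
  | A1 (α₁ α₂ α₄ β₁ : F)
  | A2 (α₁ β₁ β₂ : F)
  | A3 (α₁ β₂ : F)
  | A4 (α₁ β₂ : F)
  | A5 (α₁ : F)
  | A6 (α₁ β₁ : F)
  | A7 (α₁ : F)
  | A8 (α₁ : F)
  | A9
  | A10
  | A11
  | A12

namespace Canonical2

variable {F : Type u} [Field F]

/-- The matrix of structure constants of a canonical algebra. -/
def msc : Canonical2 F → Matrix (Fin 2) (Fin 4) F
  | A1 α₁ α₂ α₄ β₁ => !![α₁, α₂, α₂ + 1, α₄; β₁, -α₁, -α₁ + 1, -α₂]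
  | A2 α₁ β₁ β₂ => !![α₁, 0, 0, 1; β₁, β₂, 1 - α₁, 0]
  | A3 α₁ β₂ => !![α₁, 1, 1, 0; 0, β₂, 1 - α₁, 1]
  | A4 α₁ β₂ => !![α₁, 0, 0, 0; 0, β₂, 1 - α₁, 0]
  | A5 α₁ => !![α₁, 0, 0, 0; 1, 1, 1 - α₁, 0]
  | A6 α₁ β₁ => !![α₁, 0, 0, 1; β₁, 1 - α₁, α₁, 0]
  | A7 α₁ => !![α₁, 1, 1, 0; 0, 1 - α₁, α₁, 1]
  | A8 α₁ => !![α₁, 0, 0, 0; 0, 1 - α₁, α₁, 0]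
  | A9 => !![1, 0, 0, 0; 1, 0, 1, 0]
  | A10 => !![0, 1, 1, 0; 0, 0, 0, 1]
  | A11 => !![1, 1, 1, 0; 0, 1, 1, 1]
  | A12 => !![0, 0, 0, 0; 1, 0, 0, 0]

/-- The canonical algebra itself. -/
abbrev Alg (c : Canonical2 F) : Type u := MSCAlgebra c.msc

/-- First list (one nontrivial subalgebra). -/
def InList1 : Canonical2 F → Prop
  | A1 α₁ α₂ α₄ β₁ =>
      (α₄ * (α₁ + 1) + (α₂ + 1) ^ 2 = 0 ∧ (α₂ + 1) ^ 3 + β₁ * α₄ ^ 2 = 0 ∧ α₄ ≠ 0) ∨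
      (α₁ = 1 ∧ α₂ = 1 ∧ α₄ = 0 ∧ β₁ ≠ 0)
  | A2 _ β₁ β₂ => β₁ = 0 ∧ β₂ = 1
  | A3 _ _ => False
  | A4 _ _ => False
  | A5 _ => True
  | A6 α₁ β₁ => α₁ = 1 ∧ β₁ = 0
  | A7 _ => False
  | A8 _ => False
  | A9 => True
  | A10 => False
  | A11 => False
  | A12 => True

/-- Second list (two nontrivial subalgebras). -/
def InList2 : Canonical2 F → Prop
  | A1 α₁ α₂ α₄ β₁ =>
      (α₄ * β₁ + (α₁ + 1) * (α₂ + 1) = 0 ∧ α₄ * (α₄ * (α₁ + 1) + (α₂ + 1) ^ 2) ≠ 0) ∨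
      (α₁ = 1 ∧ α₄ = 0 ∧ α₂ ≠ 1) ∨
      (α₂ = 1 ∧ α₄ = 0 ∧ α₁ ≠ 1)
  | A2 _ β₁ β₂ => β₁ = 0 ∧ β₂ ≠ 1
  | A3 _ β₂ => β₂ = 1
  | A4 _ β₂ => β₂ ≠ 1
  | A5 _ => False
  | A6 α₁ β₁ => β₁ = 0 ∧ α₁ ≠ 1
  | A7 α₁ => α₁ = 1
  | A8 α₁ => α₁ ≠ 1
  | A9 => False
  | A10 => True
  | A11 => False
  | A12 => False

/-- Third list (three nontrivial subalgebras). -/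
def InList3 : Canonical2 F → Prop
  | A1 α₁ α₂ α₄ β₁ =>
      α₄ * (α₄ * β₁ + (α₁ + 1) * (α₂ + 1)) ≠ 0 ∨
      (α₄ = 0 ∧ (α₁ + 1) * (α₂ + 1) ≠ 0)
  | A2 _ β₁ _ => β₁ ≠ 0
  | A3 _ β₂ => β₂ ≠ 1
  | A4 _ _ => False
  | A5 _ => False
  | A6 _ β₁ => β₁ ≠ 0
  | A7 α₁ => α₁ ≠ 1
  | A8 _ => False
  | A9 => False
  | A10 => False
  | A11 => True
  | A12 => False

/-- Fourth list (infinitely many nontrivial subalgebras). -/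
def InListInf : Canonical2 F → Prop
  | A1 α₁ α₂ α₄ β₁ => α₁ = 1 ∧ α₂ = 1 ∧ α₄ = 0 ∧ β₁ = 0
  | A2 _ _ _ => False
  | A3 _ _ => False
  | A4 _ β₂ => β₂ = 1
  | A5 _ => False
  | A6 _ _ => False
  | A7 _ => False
  | A8 α₁ => α₁ = 1
  | A9 => False
  | A10 => False
  | A11 => False
  | A12 => False

end Canonical2

/-! A line spanned by v is a subalgebra exactly when v·v is proportional to v. In coordinates this
is the vanishing at v of a binary cubic form, so the nontrivial subalgebras are the zeros of that
form on the projective line (`MSCAlgebra.encard_nontrivialSubalgebras`). The root hypothesis splits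
every such form: a nonzero form has one, two or three zeros according to the coincidences among its
roots, and the zero form vanishes on the whole line, which is infinite. The lists are these
coincidence conditions written in the parameters (`Canonical2.count_iff`).

For the classification, the traces of right and of left multiplication are two linear forms on the
algebra. Normalising them sorts the algebras: independent forms give A1; dependent forms with right
form nonzero give A2–A5; right form zero and left form nonzero give A6–A9; both forms zero give
A10–A12. The base changes that remain reach a canonical matrix
(`HasStructureMatrix.exists_canonical`) and cannot alter its parameters
(`Canonical2.eq_of_baseChange`). Since isomorphic algebras have equally many subalgebras, the counts
carry over. -/

open Polynomial

/-! ### Structure matrices and bases -/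

section Basis

variable {F : Type u} [Field F]

/-- The product of `(x₀, x₁)` and `(y₀, y₁)` has `i`-th coordinate `prodCoord M i x₀ x₁ y₀ y₁`. -/
def prodCoord (M : Matrix (Fin 2) (Fin 4) F) (i : Fin 2) (x₀ x₁ y₀ y₁ : F) : F :=
  M i 0 * (x₀ * y₀) + M i 1 * (x₀ * y₁) + M i 2 * (x₁ * y₀) + M i 3 * (x₁ * y₁)

variable {A : Type v} [NonUnitalNonAssocRing A] [Module F A]

/-- `M` is the matrix of structure constants of `A` in the basis `b`. -/
structure IsStructureMatrix (b : Module.Basis (Fin 2) F A) (M : Matrix (Fin 2) (Fin 4) F) :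
    Prop where
  mul00 : b 0 * b 0 = M 0 0 • b 0 + M 1 0 • b 1
  mul01 : b 0 * b 1 = M 0 1 • b 0 + M 1 1 • b 1
  mul10 : b 1 * b 0 = M 0 2 • b 0 + M 1 2 • b 1
  mul11 : b 1 * b 1 = M 0 3 • b 0 + M 1 3 • b 1

theorem exists_isStructureMatrix (b : Module.Basis (Fin 2) F A) :
    ∃ M, IsStructureMatrix b M := by
  refine ⟨!![b.repr (b 0 * b 0) 0, b.repr (b 0 * b 1) 0, b.repr (b 1 * b 0) 0,
    b.repr (b 1 * b 1) 0; b.repr (b 0 * b 0) 1, b.repr (b 0 * b 1) 1, b.repr (b 1 * b 0) 1,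
    b.repr (b 1 * b 1) 1], ?_, ?_, ?_, ?_⟩
  · exact (b.sum_repr _).symm.trans (Fin.sum_univ_two _)
  · exact (b.sum_repr _).symm.trans (Fin.sum_univ_two _)
  · exact (b.sum_repr _).symm.trans (Fin.sum_univ_two _)
  · exact (b.sum_repr _).symm.trans (Fin.sum_univ_two _)

theorem IsStructureMatrix.mul_eq [IsScalarTower F A A] [SMulCommClass F A A]
    {b : Module.Basis (Fin 2) F A} {M : Matrix (Fin 2) (Fin 4) F}
    (h : IsStructureMatrix b M) (p q r s : F) :
    (p • b 0 + q • b 1) * (r • b 0 + s • b 1) =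
      prodCoord M 0 p q r s • b 0 + prodCoord M 1 p q r s • b 1 := by
  simp only [mul_add, add_mul, smul_mul_assoc, mul_smul_comm, h.mul00, h.mul01, h.mul10, h.mul11,
    prodCoord]
  module

/-- The standard basis of `MSCAlgebra M`. -/
noncomputable def MSCAlgebra.basis (M : Matrix (Fin 2) (Fin 4) F) :
    Module.Basis (Fin 2) F (MSCAlgebra M) :=
  Pi.basisFun F (Fin 2)

theorem MSCAlgebra.basis_apply (M : Matrix (Fin 2) (Fin 4) F) (i j : Fin 2) :
    MSCAlgebra.basis M i j = if i = j then 1 else 0 := by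
  have : MSCAlgebra.basis M i j = (Pi.single i 1 : Fin 2 → F) j :=
    congrFun (Pi.basisFun_apply F (Fin 2) i) j
  rw [this, Pi.single_apply]
  simp only [eq_comm]

theorem MSCAlgebra.isStructureMatrix_basis (M : Matrix (Fin 2) (Fin 4) F) :
    IsStructureMatrix (MSCAlgebra.basis M) M := by
  constructor <;> refine funext fun i => ?_ <;> fin_cases i <;>
    simp [MSCAlgebra.mul_apply, MSCAlgebra.add_apply, MSCAlgebra.smul_apply,
      MSCAlgebra.basis_apply]

/-- Turns isomorphism into a choice of basis, so that the classification becomes a question about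
base changes of matrices. -/
theorem algIsomorphic_iff [IsScalarTower F A A] [SMulCommClass F A A]
    (M : Matrix (Fin 2) (Fin 4) F) :
    AlgIsomorphic F A (MSCAlgebra M) ↔ ∃ b : Module.Basis (Fin 2) F A, IsStructureMatrix b M := by
  constructor
  · rintro ⟨e, he⟩
    have he' : ∀ x y, e.symm (x * y) = e.symm x * e.symm y := fun x y => by
      apply e.injective
      simp [he]
    have h := MSCAlgebra.isStructureMatrix_basis M
    refine ⟨(MSCAlgebra.basis M).map e.symm, ?_, ?_, ?_, ?_⟩ <;>
      simp only [Module.Basis.map_apply, ← he', ← map_smul, ← map_add, h.mul00, h.mul01, h.mul10,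
        h.mul11]
  · rintro ⟨b, hb⟩
    refine ⟨b.equivFun, fun x y => ?_⟩
    have hx := b.sum_repr x
    have hy := b.sum_repr y
    rw [Fin.sum_univ_two] at hx hy
    have hxy := hb.mul_eq (b.repr x 0) (b.repr x 1) (b.repr y 0) (b.repr y 1)
    rw [hx, hy] at hxy
    have key : ∀ c d : F, b.equivFun (c • b 0 + d • b 1) = ![c, d] := fun c d => by
      funext i
      fin_cases i <;> simp
    rw [hxy]
    refine (key _ _).trans (funext fun i => ?_)
    fin_cases i <;> rfl

/-- `M'` is obtained from `M` by passing to the vectors `p e₁ + q e₂` and `r e₁ + s e₂`. -/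
structure BaseChange (M M' : Matrix (Fin 2) (Fin 4) F) (p q r s : F) : Prop where
  det : p * s - q * r ≠ 0
  a1 : prodCoord M 0 p q p q = M' 0 0 * p + M' 1 0 * r
  b1 : prodCoord M 1 p q p q = M' 0 0 * q + M' 1 0 * s
  a2 : prodCoord M 0 p q r s = M' 0 1 * p + M' 1 1 * r
  b2 : prodCoord M 1 p q r s = M' 0 1 * q + M' 1 1 * s
  a3 : prodCoord M 0 r s p q = M' 0 2 * p + M' 1 2 * r
  b3 : prodCoord M 1 r s p q = M' 0 2 * q + M' 1 2 * s
  a4 : prodCoord M 0 r s r s = M' 0 3 * p + M' 1 3 * r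
  b4 : prodCoord M 1 r s r s = M' 0 3 * q + M' 1 3 * s

theorem exists_basis_of_det_ne_zero (b : Module.Basis (Fin 2) F A) {p q r s : F}
    (h : p * s - q * r ≠ 0) : ∃ b' : Module.Basis (Fin 2) F A,
      b' 0 = p • b 0 + q • b 1 ∧ b' 1 = r • b 0 + s • b 1 := by
  have hli : LinearIndependent F ![p • b 0 + q • b 1, r • b 0 + s • b 1] := by
    rw [LinearIndependent.pair_iff]
    intro x y hxy
    have hb := LinearIndependent.pair_iff.1
      (show LinearIndependent F ![b 0, b 1] by
        have := b.linearIndependent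
        convert this using 1
        funext i; fin_cases i <;> rfl)
      (x * p + y * r) (x * q + y * s) (by rw [← hxy]; module)
    constructor
    · refine (mul_eq_zero.1 (?_ : (p * s - q * r) * x = 0)).resolve_left h
      linear_combination s * hb.1 - r * hb.2
    · refine (mul_eq_zero.1 (?_ : (p * s - q * r) * y = 0)).resolve_left h
      linear_combination p * hb.2 - q * hb.1
  refine ⟨basisOfLinearIndependentOfCardEqFinrank hli ?_, ?_, ?_⟩
  · rw [Module.finrank_eq_card_basis b]
  · simp
  · simp

theorem IsStructureMatrix.baseChange [IsScalarTower F A A] [SMulCommClass F A A]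
    {b : Module.Basis (Fin 2) F A} {M M' : Matrix (Fin 2) (Fin 4) F} {p q r s : F}
    (h : IsStructureMatrix b M) (hc : BaseChange M M' p q r s) :
    ∃ b' : Module.Basis (Fin 2) F A, IsStructureMatrix b' M' := by
  obtain ⟨b', h0, h1⟩ := exists_basis_of_det_ne_zero b hc.det
  refine ⟨b', ?_, ?_, ?_, ?_⟩ <;> rw [h0, h1, h.mul_eq]
  · rw [hc.a1, hc.b1]; module
  · rw [hc.a2, hc.b2]; module
  · rw [hc.a3, hc.b3]; module
  · rw [hc.a4, hc.b4]; module

theorem IsStructureMatrix.exists_baseChange [IsScalarTower F A A] [SMulCommClass F A A]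
    {b b' : Module.Basis (Fin 2) F A} {M M' : Matrix (Fin 2) (Fin 4) F}
    (h : IsStructureMatrix b M) (h' : IsStructureMatrix b' M') :
    ∃ p q r s, BaseChange M M' p q r s := by
  have h0 := b.sum_repr (b' 0)
  have h1 := b.sum_repr (b' 1)
  rw [Fin.sum_univ_two] at h0 h1
  set p := b.repr (b' 0) 0
  set q := b.repr (b' 0) 1
  set r := b.repr (b' 1) 0
  set s := b.repr (b' 1) 1
  have key : ∀ x y z w : F, x • b 0 + y • b 1 = z • b 0 + w • b 1 → x = z ∧ y = w := by
    intro x y z w e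
    have e' := congrArg b.repr e
    exact ⟨by simpa using DFunLike.congr_fun e' 0, by simpa using DFunLike.congr_fun e' 1⟩
  have k00 := key _ _ (M' 0 0 * p + M' 1 0 * r) (M' 0 0 * q + M' 1 0 * s)
    ((h.mul_eq p q p q).symm.trans (by rw [h0, h'.mul00, ← h0, ← h1]; module))
  have k01 := key _ _ (M' 0 1 * p + M' 1 1 * r) (M' 0 1 * q + M' 1 1 * s)
    ((h.mul_eq p q r s).symm.trans (by rw [h0, h1, h'.mul01, ← h0, ← h1]; module))
  have k10 := key _ _ (M' 0 2 * p + M' 1 2 * r) (M' 0 2 * q + M' 1 2 * s)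
    ((h.mul_eq r s p q).symm.trans (by rw [h0, h1, h'.mul10, ← h0, ← h1]; module))
  have k11 := key _ _ (M' 0 3 * p + M' 1 3 * r) (M' 0 3 * q + M' 1 3 * s)
    ((h.mul_eq r s r s).symm.trans (by rw [h1, h'.mul11, ← h0, ← h1]; module))
  refine ⟨p, q, r, s, ?_, k00.1, k00.2, k01.1, k01.2, k10.1, k10.2, k11.1, k11.2⟩
  -- If the determinant vanished, these two combinations of the new basis vectors would be zero,
  -- forcing p = q = 0 and hence `b' 0 = 0`.
  intro hd
  have hli := LinearIndependent.pair_iff.1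
      (show LinearIndependent F ![b' 0, b' 1] by
        have := b'.linearIndependent
        convert this using 1
        funext i; fin_cases i <;> rfl)
  have e1 := hli s (-q) (by
    have : s • (p • b 0 + q • b 1) + -q • (r • b 0 + s • b 1) = (p * s - q * r) • b 0 := by module
    rw [← h0, ← h1, this, hd, zero_smul])
  have e2 := hli r (-p) (by
    have : r • (p • b 0 + q • b 1) + -p • (r • b 0 + s • b 1) = (-(p * s - q * r)) • b 1 := by
      module
    rw [← h0, ← h1, this, hd, neg_zero, zero_smul])
  have hp : p = 0 := by simpa using e2.2
  have hq : q = 0 := by simpa using e1.2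
  have : b' 0 = 0 := by rw [← h0, hp, hq]; simp
  exact b'.ne_zero 0 this

end Basis

/-! ### Entries of explicit 2×4 matrices -/

section Entries

variable {F : Type u} (a b c d e f g h : F)

theorem matrix24_apply_00 : !![a, b, c, d; e, f, g, h] 0 0 = a := rfl

theorem matrix24_apply_01 : !![a, b, c, d; e, f, g, h] 0 1 = b := rfl

theorem matrix24_apply_02 : !![a, b, c, d; e, f, g, h] 0 2 = c := rfl

theorem matrix24_apply_03 : !![a, b, c, d; e, f, g, h] 0 3 = d := rfl

theorem matrix24_apply_10 : !![a, b, c, d; e, f, g, h] 1 0 = e := rfl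

theorem matrix24_apply_11 : !![a, b, c, d; e, f, g, h] 1 1 = f := rfl

theorem matrix24_apply_12 : !![a, b, c, d; e, f, g, h] 1 2 = g := rfl

theorem matrix24_apply_13 : !![a, b, c, d; e, f, g, h] 1 3 = h := rfl

end Entries

/-! ### Trace forms, and uniqueness of the canonical matrix -/

section BaseChange

variable {F : Type u} [Field F] {M M' : Matrix (Fin 2) (Fin 4) F} {p q r s : F}

theorem exists_baseChange (M : Matrix (Fin 2) (Fin 4) F) {p q r s : F} (h : p * s - q * r ≠ 0) :
    ∃ M', BaseChange M M' p q r s := by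
  -- Cramer's rule: `f` and `g` are the coordinates of a product in the new basis.
  let f := fun x y z w => (prodCoord M 0 x y z w * s - prodCoord M 1 x y z w * r) / (p * s - q * r)
  let g := fun x y z w => (prodCoord M 1 x y z w * p - prodCoord M 0 x y z w * q) / (p * s - q * r)
  have hf : ∀ x y z w, prodCoord M 0 x y z w = f x y z w * p + g x y z w * r := fun x y z w => by
    simp only [f, g]; rw [div_mul_eq_mul_div, div_mul_eq_mul_div, ← add_div, eq_div_iff h]; ring
  have hg : ∀ x y z w, prodCoord M 1 x y z w = f x y z w * q + g x y z w * s := fun x y z w => by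
    simp only [f, g]; rw [div_mul_eq_mul_div, div_mul_eq_mul_div, ← add_div, eq_div_iff h]; ring
  exact ⟨!![f p q p q, f p q r s, f r s p q, f r s r s; g p q p q, g p q r s, g r s p q, g r s r s],
    h, hf .., hg .., hf .., hg .., hf .., hg .., hf .., hg ..⟩

namespace BaseChange

/-- The trace of x ↦ xv does not depend on the basis and is linear in v; here v is the first new
basis vector. -/
theorem trace_right₁ (h : BaseChange M M' p q r s) :
    M' 0 0 + M' 1 2 = p * (M 0 0 + M 1 2) + q * (M 0 1 + M 1 3) := by
  have h1 := h.a1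
  have h2 := h.b1
  have h3 := h.a3
  have h4 := h.b3
  simp only [prodCoord] at h1 h2 h3 h4
  apply mul_left_cancel₀ h.det
  linear_combination -s * h1 + r * h2 + q * h3 - p * h4

theorem trace_right₂ (h : BaseChange M M' p q r s) :
    M' 0 1 + M' 1 3 = r * (M 0 0 + M 1 2) + s * (M 0 1 + M 1 3) := by
  have h1 := h.a2
  have h2 := h.b2
  have h3 := h.a4
  have h4 := h.b4
  simp only [prodCoord] at h1 h2 h3 h4
  apply mul_left_cancel₀ h.det
  linear_combination -s * h1 + r * h2 + q * h3 - p * h4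

theorem trace_left₁ (h : BaseChange M M' p q r s) :
    M' 0 0 + M' 1 1 = p * (M 0 0 + M 1 1) + q * (M 0 2 + M 1 3) := by
  have h1 := h.a1
  have h2 := h.b1
  have h3 := h.a2
  have h4 := h.b2
  simp only [prodCoord] at h1 h2 h3 h4
  apply mul_left_cancel₀ h.det
  linear_combination -s * h1 + r * h2 + q * h3 - p * h4

theorem trace_left₂ (h : BaseChange M M' p q r s) :
    M' 0 2 + M' 1 3 = r * (M 0 0 + M 1 1) + s * (M 0 2 + M 1 3) := by
  have h1 := h.a3
  have h2 := h.b3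
  have h3 := h.a4
  have h4 := h.b4
  simp only [prodCoord] at h1 h2 h3 h4
  apply mul_left_cancel₀ h.det
  linear_combination -s * h1 + r * h2 + q * h3 - p * h4

end BaseChange

-- The traces confine the base change: between members of A1 it is the identity, and within A2–A5 or
-- A6–A9 it has p = 1, r = 0. The multiplication equations then leave only base changes that fix the
-- parameters, and they separate the families with equal traces.
set_option maxHeartbeats 1600000 in
open Canonical2 in
theorem Canonical2.eq_of_baseChange [CharP F 2] {c c' : Canonical2 F}
    (h : BaseChange c.msc c'.msc p q r s) : c = c' := by
  have t1 := h.trace_right₁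
  have t2 := h.trace_right₂
  have t3 := h.trace_left₁
  have t4 := h.trace_left₂
  obtain ⟨h0, h1, h2, h3, h4, h5, h6, h7, h8⟩ := h
  -- In characteristic 2 the only square root of 1 is 1, so rescaling by a sign leaves no ambiguity.
  have hs : s * s = 1 → s = 1 := fun h => by
    have : (s - 1) * (s - 1) = 0 := by grind
    exact sub_eq_zero.1 (mul_self_eq_zero.1 this)
  rcases c <;> rcases c' <;>
    simp only [msc, prodCoord, matrix24_apply_00, matrix24_apply_01, matrix24_apply_02,
      matrix24_apply_03, matrix24_apply_10, matrix24_apply_11,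
      matrix24_apply_12, matrix24_apply_13] at * <;> grind

end BaseChange

/-! ### Consequences of the root hypothesis -/

section Roots

variable {F : Type u} [Field F]


theorem exists_quadratic_root
    (hF : ∀ p : Polynomial F, p.natDegree = 2 ∨ p.natDegree = 3 → ∃ x : F, p.IsRoot x)
    {a : F} (b c : F) (ha : a ≠ 0) :
    ∃ x : F, a * x ^ 2 + b * x + c = 0 := by
  obtain ⟨x, hx⟩ := hF (C a * X ^ 2 + C b * X + C c) (Or.inl (natDegree_quadratic ha))
  exact ⟨x, by simpa [IsRoot.def] using hx⟩

theorem exists_cubic_root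
    (hF : ∀ p : Polynomial F, p.natDegree = 2 ∨ p.natDegree = 3 → ∃ x : F, p.IsRoot x)
    {a : F} (b c d : F) (ha : a ≠ 0) :
    ∃ x : F, a * x ^ 3 + b * x ^ 2 + c * x + d = 0 := by
  obtain ⟨x, hx⟩ := hF (C a * X ^ 3 + C b * X ^ 2 + C c * X + C d) (Or.inr (natDegree_cubic ha))
  exact ⟨x, by simpa [IsRoot.def] using hx⟩

theorem infinite_of_exists_root [CharP F 2]
    (hF : ∀ p : Polynomial F, p.natDegree = 2 ∨ p.natDegree = 3 → ∃ x : F, p.IsRoot x) :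
    Infinite F := by
  by_contra hfin
  rw [not_infinite_iff_finite] at hfin
  -- The map x ↦ x² + x is onto but takes the same value at 0 and 1, which is impossible on a finite
  -- set.
  have hsurj : Function.Surjective (fun x : F => x ^ 2 + x) := fun c => by
    obtain ⟨x, hx⟩ := exists_quadratic_root hF 1 (-c) one_ne_zero
    exact ⟨x, by linear_combination hx⟩
  have h := Finite.injective_iff_surjective.2 hsurj
    (show (fun x : F => x ^ 2 + x) 0 = (fun x : F => x ^ 2 + x) 1 by grind)
  exact zero_ne_one h

end Roots

/-- A change of basis normalises a nonzero trace form `(x, y)` to `(1, 0)`. -/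
theorem exists_normalizing {F : Type u} [Field F] {x y : F} (h : x ≠ 0 ∨ y ≠ 0) :
    ∃ p q r s : F, p * s - q * r ≠ 0 ∧ p * x + q * y = 1 ∧ r * x + s * y = 0 := by
  by_cases hx : x = 0
  · have hy := h.resolve_left (not_not.2 hx)
    exact ⟨0, y⁻¹, 1, 0, by simpa using hy, by simp [hy], by simp [hx]⟩
  · exact ⟨x⁻¹, 0, -y, x, by simp [hx], by simp [hx], by ring⟩

/-! ### Reduction to a canonical matrix -/

section Existence

variable {F : Type u} [Field F] {A : Type v} [NonUnitalNonAssocRing A] [Module F A]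

variable (A) in
/-- `M` is the matrix of structure constants of `A` in some basis. -/
def HasStructureMatrix (M : Matrix (Fin 2) (Fin 4) F) : Prop :=
  ∃ b : Module.Basis (Fin 2) F A, IsStructureMatrix b M

variable [IsScalarTower F A A] [SMulCommClass F A A] {M M' : Matrix (Fin 2) (Fin 4) F}

namespace HasStructureMatrix

theorem baseChange {p q r s : F} (h : HasStructureMatrix A M) (hc : BaseChange M M' p q r s) :
    HasStructureMatrix A M' := by
  obtain ⟨b, hb⟩ := h
  exact hb.baseChange hc

theorem ne_zero (h : HasStructureMatrix A M) (hA : ∃ x y : A, x * y ≠ 0) : M ≠ 0 := by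
  rintro rfl
  obtain ⟨b, hb⟩ := h
  obtain ⟨x, y, hxy⟩ := hA
  have hx := b.sum_repr x
  have hy := b.sum_repr y
  rw [Fin.sum_univ_two] at hx hy
  apply hxy
  rw [← hx, ← hy, hb.mul_eq]
  simp [prodCoord]

variable [CharP F 2]

open Canonical2


theorem exists_canonical_of_traces_independent (h : HasStructureMatrix A M)
    (hd : (M 0 0 + M 1 2) * (M 0 2 + M 1 3) - (M 0 1 + M 1 3) * (M 0 0 + M 1 1) ≠ 0) :
    ∃ c : Canonical2 F, HasStructureMatrix A c.msc := by
  set x := M 0 0 + M 1 2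
  set y := M 0 1 + M 1 3
  set z := M 0 0 + M 1 1
  set w := M 0 2 + M 1 3
  obtain ⟨d, hdd⟩ : ∃ d, d = x * w - y * z := ⟨_, rfl⟩
  rw [← hdd] at hd
  -- The new vectors form the basis dual to the right and left trace forms.
  obtain ⟨M', hM'⟩ := exists_baseChange M (p := w / d) (q := -z / d) (r := -y / d) (s := x / d) (by
    have : w / d * (x / d) - -z / d * (-y / d) = 1 / d := by
      field_simp; linear_combination -hdd
    rw [this]
    exact one_div_ne_zero hd)
  have t1 : M' 0 0 + M' 1 2 = 1 := by
    rw [hM'.trace_right₁]; field_simp; linear_combination -hdd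
  have t2 : M' 0 1 + M' 1 3 = 0 := by
    rw [hM'.trace_right₂]; ring
  have t3 : M' 0 0 + M' 1 1 = 0 := by
    rw [hM'.trace_left₁]; ring
  have t4 : M' 0 2 + M' 1 3 = 1 := by
    rw [hM'.trace_left₂]; field_simp; linear_combination -hdd
  refine ⟨A1 (M' 0 0) (M' 0 1) (M' 0 3) (M' 1 0), (h.baseChange hM').baseChange
    (p := 1) (q := 0) (r := 0) (s := 1) ?_⟩
  constructor <;> try simp only [msc, prodCoord, matrix24_apply_00, matrix24_apply_01,
    matrix24_apply_02, matrix24_apply_03, matrix24_apply_10, matrix24_apply_11,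
    matrix24_apply_12, matrix24_apply_13]
  all_goals grind

/-- The base changes still available are e₁ ↦ e₁ + q e₂, e₂ ↦ s e₂. If α₄ ≠ 0, scaling makes the
square of the new e₂ equal to the new e₁: this is A2. Otherwise q should make e₁ + q e₂ span a
subalgebra, that is, β₁ + (β₂ + 1)q + β₄q² = 0. This gives A3 or A4, and is unsolvable only for β₄ =
0, β₂ = 1, β₁ ≠ 0, which gives A5. -/
theorem exists_canonical_of_trace_right
    (hF : ∀ p : Polynomial F, p.natDegree = 2 ∨ p.natDegree = 3 → ∃ x : F, p.IsRoot x)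
    (h : HasStructureMatrix A M)
    (t1 : M 0 0 + M 1 2 = 1) (t2 : M 0 1 + M 1 3 = 0) (t4 : M 0 2 + M 1 3 = 0) :
    ∃ c : Canonical2 F, HasStructureMatrix A c.msc := by
  by_cases h4 : M 0 3 = 0
  · by_cases ha : M 1 3 = 0
    · by_cases hb : M 1 1 = 1
      · by_cases h0 : M 1 0 = 0
        · refine ⟨A4 (M 0 0) 1, h.baseChange (p := 1) (q := 0) (r := 0) (s := 1) ?_⟩
          constructor <;> try simp only [msc, prodCoord, matrix24_apply_00, matrix24_apply_01,
    matrix24_apply_02, matrix24_apply_03, matrix24_apply_10, matrix24_apply_11,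
    matrix24_apply_12, matrix24_apply_13]
          all_goals grind
        · refine ⟨A5 (M 0 0), h.baseChange (p := 1) (q := 0) (r := 0) (s := M 1 0) ?_⟩
          constructor <;> try simp only [msc, prodCoord, matrix24_apply_00, matrix24_apply_01,
    matrix24_apply_02, matrix24_apply_03, matrix24_apply_10, matrix24_apply_11,
    matrix24_apply_12, matrix24_apply_13]
          all_goals grind
      · refine ⟨A4 (M 0 0) (M 1 1), h.baseChange
          (p := 1) (q := -M 1 0 / (M 1 1 - 1)) (r := 0) (s := 1) ?_⟩
        constructor <;> try simp only [msc, prodCoord, matrix24_apply_00, matrix24_apply_01,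
    matrix24_apply_02, matrix24_apply_03, matrix24_apply_10, matrix24_apply_11,
    matrix24_apply_12, matrix24_apply_13]
        all_goals grind
    · obtain ⟨t, ht⟩ := exists_quadratic_root hF (M 1 1 + 1) (M 1 0 * M 1 3) one_ne_zero
      refine ⟨A3 (M 0 0) (M 1 1), h.baseChange
        (p := 1) (q := t / M 1 3) (r := 0) (s := (M 1 3)⁻¹) ?_⟩
      constructor <;> try simp only [msc, prodCoord, matrix24_apply_00, matrix24_apply_01,
    matrix24_apply_02, matrix24_apply_03, matrix24_apply_10, matrix24_apply_11,
    matrix24_apply_12, matrix24_apply_13]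
      all_goals grind
  · obtain ⟨s, hs⟩ := exists_quadratic_root hF 0 (-1) h4
    refine ⟨A2 (M 0 0 + M 1 3 ^ 2 / M 0 3) ((M 1 0 + M 1 3 / M 0 3 * (M 1 1 + 1)) / s)
      (M 1 1 + M 1 3 ^ 2 / M 0 3),
      h.baseChange (p := 1) (q := M 1 3 / M 0 3) (r := 0) (s := s) ?_⟩
    constructor <;> try simp only [msc, prodCoord, matrix24_apply_00, matrix24_apply_01,
      matrix24_apply_02, matrix24_apply_03, matrix24_apply_10, matrix24_apply_11,
      matrix24_apply_12, matrix24_apply_13]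
    all_goals grind

/-- The same reduction with the left form normalised; the equation for q is now β₁ + (α₁ + 1)q +
β₄q² = 0, and its unsolvable case is A9. -/
theorem exists_canonical_of_trace_left
    (hF : ∀ p : Polynomial F, p.natDegree = 2 ∨ p.natDegree = 3 → ∃ x : F, p.IsRoot x)
    (h : HasStructureMatrix A M)
    (t1 : M 0 0 + M 1 2 = 0) (t2 : M 0 1 + M 1 3 = 0) (t3 : M 0 0 + M 1 1 = 1)
    (t4 : M 0 2 + M 1 3 = 0) :
    ∃ c : Canonical2 F, HasStructureMatrix A c.msc := by
  by_cases h4 : M 0 3 = 0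
  · by_cases ha : M 1 3 = 0
    · by_cases hb : M 0 0 = 1
      · by_cases h0 : M 1 0 = 0
        · refine ⟨A8 1, h.baseChange (p := 1) (q := 0) (r := 0) (s := 1) ?_⟩
          constructor <;> try simp only [msc, prodCoord, matrix24_apply_00, matrix24_apply_01,
            matrix24_apply_02, matrix24_apply_03, matrix24_apply_10, matrix24_apply_11,
            matrix24_apply_12, matrix24_apply_13]
          all_goals grind
        · refine ⟨A9, h.baseChange (p := 1) (q := 0) (r := 0) (s := M 1 0) ?_⟩
          constructor <;> try simp only [msc, prodCoord, matrix24_apply_00, matrix24_apply_01,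
            matrix24_apply_02, matrix24_apply_03, matrix24_apply_10, matrix24_apply_11,
            matrix24_apply_12, matrix24_apply_13]
          all_goals grind
      · refine ⟨A8 (M 0 0), h.baseChange
          (p := 1) (q := M 1 0 / (M 0 0 - 1)) (r := 0) (s := 1) ?_⟩
        constructor <;> try simp only [msc, prodCoord, matrix24_apply_00, matrix24_apply_01,
          matrix24_apply_02, matrix24_apply_03, matrix24_apply_10, matrix24_apply_11,
          matrix24_apply_12, matrix24_apply_13]
        all_goals grind
    · obtain ⟨t, ht⟩ := exists_quadratic_root hF (M 0 0 + 1) (M 1 0 * M 1 3) one_ne_zero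
      refine ⟨A7 (M 0 0), h.baseChange
        (p := 1) (q := t / M 1 3) (r := 0) (s := (M 1 3)⁻¹) ?_⟩
      constructor <;> try simp only [msc, prodCoord, matrix24_apply_00, matrix24_apply_01,
        matrix24_apply_02, matrix24_apply_03, matrix24_apply_10, matrix24_apply_11,
        matrix24_apply_12, matrix24_apply_13]
      all_goals grind
  · obtain ⟨s, hs⟩ := exists_quadratic_root hF 0 (-1) h4
    refine ⟨A6 (M 0 0 + M 1 3 ^ 2 / M 0 3) ((M 1 0 + M 1 3 / M 0 3 * (M 0 0 + 1)) / s),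
      h.baseChange (p := 1) (q := M 1 3 / M 0 3) (r := 0) (s := s) ?_⟩
    constructor <;> try simp only [msc, prodCoord, matrix24_apply_00, matrix24_apply_01,
      matrix24_apply_02, matrix24_apply_03, matrix24_apply_10, matrix24_apply_11,
      matrix24_apply_12, matrix24_apply_13]
    all_goals grind

/-- An algebra without trace forms, one of whose basis vectors spans a subalgebra. -/
theorem exists_canonical_of_traceless_of_sq
    (hF : ∀ p : Polynomial F, p.natDegree = 2 ∨ p.natDegree = 3 → ∃ x : F, p.IsRoot x)
    (hA : ∃ x y : A, x * y ≠ 0) (h : HasStructureMatrix A M)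
    (t1 : M 0 0 + M 1 2 = 0) (t2 : M 0 1 + M 1 3 = 0) (t3 : M 0 0 + M 1 1 = 0)
    (t4 : M 0 2 + M 1 3 = 0) (h4 : M 0 3 = 0) :
    ∃ c : Canonical2 F, HasStructureMatrix A c.msc := by
  -- With all traces zero, characteristic 2 makes the structure constants the coefficients of the
  -- cubic form β₁x³ + α₁x²y + β₄xy² + α₄y³. Thus A12, A10 and A11 are x³, xy² and x²y + xy²: a
  -- triple zero, a double zero, three distinct zeros.
  by_cases hb : M 1 3 = 0
  · by_cases ha : M 0 0 = 0
    · have hd : M 1 0 ≠ 0 := fun hd => h.ne_zero hA <| by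
        ext i j
        fin_cases i <;> fin_cases j <;> simp only [Fin.zero_eta, Fin.mk_one, Fin.isValue,
          Fin.reduceFinMk, Matrix.zero_apply] <;> grind
      refine ⟨A12, h.baseChange (p := 1) (q := 0) (r := 0) (s := M 1 0) ?_⟩
      constructor <;> try simp only [msc, prodCoord, matrix24_apply_00, matrix24_apply_01,
        matrix24_apply_02, matrix24_apply_03, matrix24_apply_10, matrix24_apply_11,
        matrix24_apply_12, matrix24_apply_13]
      all_goals grind
    -- Here e₂ is the double zero; it becomes the first vector and the simple zero the second.
    · refine ⟨A10, h.baseChange (p := 0) (q := 1) (r := (M 0 0)⁻¹) (s := M 1 0 / M 0 0 ^ 2) ?_⟩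
      constructor <;> try simp only [msc, prodCoord, matrix24_apply_00, matrix24_apply_01,
        matrix24_apply_02, matrix24_apply_03, matrix24_apply_10, matrix24_apply_11,
        matrix24_apply_12, matrix24_apply_13]
      all_goals grind
  -- The vector e₁ + t e₂ is a further zero of the form, double when α₁ = 0 and simple otherwise.
  · obtain ⟨t, ht⟩ := exists_quadratic_root hF (M 0 0) (M 1 0) hb
    by_cases ha : M 0 0 = 0
    · refine ⟨A10, h.baseChange (p := 1) (q := t) (r := 0) (s := (M 1 3)⁻¹) ?_⟩
      constructor <;> try simp only [msc, prodCoord, matrix24_apply_00, matrix24_apply_01,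
        matrix24_apply_02, matrix24_apply_03, matrix24_apply_10, matrix24_apply_11,
        matrix24_apply_12, matrix24_apply_13]
      all_goals grind
    · refine ⟨A11, h.baseChange
        (p := (M 0 0)⁻¹) (q := t / M 0 0) (r := 0) (s := (M 1 3)⁻¹) ?_⟩
      constructor <;> try simp only [msc, prodCoord, matrix24_apply_00, matrix24_apply_01,
        matrix24_apply_02, matrix24_apply_03, matrix24_apply_10, matrix24_apply_11,
        matrix24_apply_12, matrix24_apply_13]
      all_goals grind

theorem exists_canonical
    (hF : ∀ p : Polynomial F, p.natDegree = 2 ∨ p.natDegree = 3 → ∃ x : F, p.IsRoot x)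
    (hA : ∃ x y : A, x * y ≠ 0) (h : HasStructureMatrix A M) :
    ∃ c : Canonical2 F, HasStructureMatrix A c.msc := by
  by_cases hd : (M 0 0 + M 1 2) * (M 0 2 + M 1 3) - (M 0 1 + M 1 3) * (M 0 0 + M 1 1) = 0
  swap
  · exact h.exists_canonical_of_traces_independent hd
  by_cases ht : M 0 0 + M 1 2 ≠ 0 ∨ M 0 1 + M 1 3 ≠ 0
  · obtain ⟨p, q, r, s, h0, h1, h2⟩ := exists_normalizing ht
    obtain ⟨M', hM'⟩ := exists_baseChange M h0
    refine (h.baseChange hM').exists_canonical_of_trace_right hF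
      (hM'.trace_right₁.trans h1) (hM'.trace_right₂.trans h2) (hM'.trace_left₂.trans ?_)
    linear_combination (-(r * (M 0 0 + M 1 1) + s * (M 0 2 + M 1 3))) * h1
      + (p * (M 0 0 + M 1 1) + q * (M 0 2 + M 1 3)) * h2 + (p * s - q * r) * hd
  obtain ⟨t1, t2⟩ : M 0 0 + M 1 2 = 0 ∧ M 0 1 + M 1 3 = 0 := by simpa [not_or] using ht
  by_cases ht' : M 0 0 + M 1 1 ≠ 0 ∨ M 0 2 + M 1 3 ≠ 0
  · obtain ⟨p, q, r, s, h0, h1, h2⟩ := exists_normalizing ht'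
    obtain ⟨M', hM'⟩ := exists_baseChange M h0
    exact (h.baseChange hM').exists_canonical_of_trace_left hF
      (hM'.trace_right₁.trans (by rw [t1, t2]; ring))
      (hM'.trace_right₂.trans (by rw [t1, t2]; ring))
      (hM'.trace_left₁.trans h1) (hM'.trace_left₂.trans h2)
  obtain ⟨t3, t4⟩ : M 0 0 + M 1 1 = 0 ∧ M 0 2 + M 1 3 = 0 := by simpa [not_or] using ht'
  by_cases h4 : M 0 3 = 0
  · exact h.exists_canonical_of_traceless_of_sq hF hA t1 t2 t3 t4 h4
  -- The second new vector is taken to be a zero of the cubic form, so that it spans a subalgebra.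
  obtain ⟨p, q, r, s, h0, h1⟩ : ∃ p q r s : F, p * s - q * r ≠ 0 ∧
      s * prodCoord M 0 r s r s - r * prodCoord M 1 r s r s = 0 := by
    by_cases hd : M 1 0 = 0
    · exact ⟨0, 1, 1, 0, by simp, by simp [prodCoord, hd]⟩
    · obtain ⟨t, ht⟩ := exists_cubic_root hF (M 0 0) (M 1 3) (M 0 3) hd
      exact ⟨1, 0, t, 1, by simp, by simp only [prodCoord]; grind⟩
  obtain ⟨M', hM'⟩ := exists_baseChange M h0
  refine (h.baseChange hM').exists_canonical_of_traceless_of_sq hF hA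
      (hM'.trace_right₁.trans (by rw [t1, t2]; ring))
      (hM'.trace_right₂.trans (by rw [t1, t2]; ring))
      (hM'.trace_left₁.trans (by rw [t3, t4]; ring))
      (hM'.trace_left₂.trans (by rw [t3, t4]; ring))
      ((mul_eq_zero.1 (?_ : (p * s - q * r) * M' 0 3 = 0)).resolve_left h0)
  linear_combination h1 - s * hM'.a4 + r * hM'.b4

end HasStructureMatrix

end Existence

/-! ### Subalgebras as zeros of a binary cubic form -/

section Counting

variable {F : Type u} [Field F]

/-- The zeros on the projective line of the binary cubic form `a x³ + b x² y + c x y² + d y³`;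
`some t` is the point `(1 : t)` and `none` is the point `(0 : 1)`. -/
def projectiveRoots (a b c d : F) : Set (Option F) :=
  {o | o.elim (d = 0) fun t => a + b * t + c * t ^ 2 + d * t ^ 3 = 0}

@[simp]
theorem none_mem_projectiveRoots (a b c d : F) : none ∈ projectiveRoots a b c d ↔ d = 0 := Iff.rfl

@[simp]
theorem some_mem_projectiveRoots (a b c d t : F) :
    some t ∈ projectiveRoots a b c d ↔ a + b * t + c * t ^ 2 + d * t ^ 3 = 0 := Iff.rfl

/-- The vector of `F²` representing a point of the projective line. -/
def MSCAlgebra.pointVec (M : Matrix (Fin 2) (Fin 4) F) : Option F → MSCAlgebra M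
  | some t => (![1, t] : Fin 2 → F)
  | none => (![0, 1] : Fin 2 → F)

namespace MSCAlgebra

variable (M : Matrix (Fin 2) (Fin 4) F)

theorem pointVec_ne_zero (o : Option F) : pointVec M o ≠ 0 := by
  cases o with
  | none => intro h; exact one_ne_zero (congrFun h 1)
  | some t => intro h; exact one_ne_zero (congrFun h 0)

theorem exists_eq_smul_pointVec {v : MSCAlgebra M} (hv : v ≠ 0) :
    ∃ (o : Option F) (c : F), pointVec M o = c • v := by
  by_cases h0 : v 0 = 0
  · have h1 : v 1 ≠ 0 := fun h1 => hv (funext fun i => by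
      fin_cases i
      · exact h0
      · exact h1)
    refine ⟨none, (v 1)⁻¹, funext fun i => ?_⟩
    rw [smul_apply]
    fin_cases i
    · change 0 = _ * v 0; rw [h0, mul_zero]
    · exact (inv_mul_cancel₀ h1).symm
  · refine ⟨some (v 1 / v 0), (v 0)⁻¹, funext fun i => ?_⟩
    rw [smul_apply]
    fin_cases i
    · exact (inv_mul_cancel₀ h0).symm
    · exact div_eq_inv_mul _ _

theorem span_pointVec_injective :
    Function.Injective fun o => Submodule.span F {pointVec M o} := by
  intro o o' h
  obtain ⟨c, hc⟩ := Submodule.mem_span_singleton.1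
    ((show Submodule.span F {pointVec M o} = Submodule.span F {pointVec M o'} from h) ▸
      Submodule.mem_span_singleton_self (pointVec M o))
  have h0 : c * pointVec M o' 0 = pointVec M o 0 := congrFun hc 0
  have h1 : c * pointVec M o' 1 = pointVec M o 1 := congrFun hc 1
  cases o <;> cases o' <;> simp [pointVec] at h0 h1 ⊢ <;> grind

/-- For v = (x, y), the cubic form is x(v·v)₁ − y(v·v)₀, the determinant testing whether v·v is
proportional to v. -/
theorem exists_pointVec_mul_self_iff (o : Option F) :
    (∃ k : F, pointVec M o * pointVec M o = k • pointVec M o) ↔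
      o ∈ projectiveRoots (M 1 0) (M 1 1 + M 1 2 - M 0 0) (M 1 3 - M 0 1 - M 0 2) (-M 0 3) := by
  constructor
  · rintro ⟨k, hk⟩
    have h0 := congrFun hk 0
    have h1 := congrFun hk 1
    rw [smul_apply, mul_apply] at h0 h1
    cases o <;> simp [pointVec] at h0 h1 ⊢ <;> grind
  · intro h
    cases o with
    | none =>
      refine ⟨M 1 3, funext fun i => ?_⟩
      rw [smul_apply, mul_apply]
      fin_cases i <;> simp [pointVec] at h ⊢
      all_goals grind
    | some t =>
      -- Since the first coordinate of the vector is 1, the scalar is the first coordinate of its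
      -- square.
      refine ⟨M 0 0 + M 0 1 * t + M 0 2 * t + M 0 3 * t ^ 2, funext fun i => ?_⟩
      rw [smul_apply, mul_apply]
      fin_cases i <;> simp [pointVec] at h ⊢ <;> grind

theorem image_toSubmodule_nontrivialSubalgebras :
    NonUnitalSubalgebra.toSubmodule '' nontrivialSubalgebras F (MSCAlgebra M) =
      (fun o => Submodule.span F {pointVec M o}) ''
        projectiveRoots (M 1 0) (M 1 1 + M 1 2 - M 0 0) (M 1 3 - M 0 1 - M 0 2) (-M 0 3) := by
  ext W
  constructor
  · rintro ⟨S, hS, rfl⟩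
    obtain ⟨⟨v, hvS⟩, hv0, hv⟩ := finrank_eq_one_iff'.1
      (show Module.finrank F S.toSubmodule = 1 from hS)
    obtain ⟨o, c, ho⟩ := exists_eq_smul_pointVec M (v := v) fun h => hv0 (Subtype.ext h)
    have hoS : pointVec M o ∈ S.toSubmodule := ho ▸ S.toSubmodule.smul_mem c hvS
    have hc : c ≠ 0 := by
      rintro rfl
      exact pointVec_ne_zero M o (by rw [ho, zero_smul])
    have hgen : ∀ w ∈ S.toSubmodule, ∃ k : F, w = k • pointVec M o := fun w hw => by
      obtain ⟨k, hk⟩ := hv ⟨w, hw⟩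
      have hk' : k • v = w := congrArg Subtype.val hk
      exact ⟨k * c⁻¹, by rw [ho, smul_smul, mul_assoc, inv_mul_cancel₀ hc, mul_one, hk']⟩
    refine ⟨o, (exists_pointVec_mul_self_iff M o).1
      (hgen _ (S.mul_mem hoS hoS)), le_antisymm ?_ fun w hw => ?_⟩
    · simpa using hoS
    · obtain ⟨k, hk⟩ := hgen w hw
      exact Submodule.mem_span_singleton.2 ⟨k, hk.symm⟩
  · rintro ⟨o, ho, rfl⟩
    obtain ⟨k, hk⟩ := (exists_pointVec_mul_self_iff M o).2 ho
    let S : NonUnitalSubalgebra F (MSCAlgebra M) :=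
      { Submodule.span F {pointVec M o} with
        mul_mem' := by
          intro x y hx hy
          obtain ⟨a, rfl⟩ := Submodule.mem_span_singleton.1 hx
          obtain ⟨b, rfl⟩ := Submodule.mem_span_singleton.1 hy
          refine Submodule.mem_span_singleton.2 ⟨a * b * k, ?_⟩
          rw [smul_mul_assoc, mul_smul_comm, hk, smul_smul, smul_smul, mul_assoc] }
    exact ⟨S, finrank_span_singleton (pointVec_ne_zero M o), rfl⟩

theorem encard_nontrivialSubalgebras :
    (nontrivialSubalgebras F (MSCAlgebra M)).encard =
      (projectiveRoots (M 1 0) (M 1 1 + M 1 2 - M 0 0) (M 1 3 - M 0 1 - M 0 2)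
        (-M 0 3)).encard := by
  rw [← NonUnitalSubalgebra.toSubmodule_injective.encard_image,
    image_toSubmodule_nontrivialSubalgebras, (span_pointVec_injective M).encard_image]

end MSCAlgebra

/-! ### Counting the zeros of a cubic form -/

section Factor

variable {a b c d : F}

theorem exists_projectiveRoots_eq_linear (hb : b ≠ 0) :
    ∃ x : F, projectiveRoots a b 0 0 = {none, some x} := by
  refine ⟨-a / b, ?_⟩
  ext o
  cases o with
  | none => simp
  | some t =>
    simp only [some_mem_projectiveRoots]
    simp
    grind

theorem projectiveRoots_eq_singleton (ha : a ≠ 0) : projectiveRoots a 0 0 0 = {none} := by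
  ext o
  cases o <;> simp [ha]

variable [CharP F 2]

theorem exists_projectiveRoots_eq_cubic
    (hF : ∀ p : Polynomial F, p.natDegree = 2 ∨ p.natDegree = 3 → ∃ x : F, p.IsRoot x)
    (hd : d ≠ 0) :
    ∃ x y z : F, c = d * (x + y + z) ∧ b = d * (x * y + x * z + y * z) ∧ a = d * (x * y * z) ∧
      projectiveRoots a b c d = {some x, some y, some z} := by
  obtain ⟨x, hx⟩ := exists_cubic_root hF c b a hd
  -- The quadratic is the quotient of the cubic by t − x; the third root comes from the sum of the
  -- roots, with no signs in characteristic 2.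
  obtain ⟨y, hy⟩ := exists_quadratic_root hF (c + d * x) (b + (c + d * x) * x) hd
  have h1 : c = d * (x + y + (c / d + x + y)) := by grind
  generalize c / d + x + y = z at h1
  have h2 : b = d * (x * y + x * z + y * z) := by grind
  have h3 : a = d * (x * y * z) := by grind
  refine ⟨x, y, z, h1, h2, h3, ?_⟩
  ext o
  cases o with
  | none => simpa using hd
  | some t =>
    have : a + b * t + c * t ^ 2 + d * t ^ 3 = d * ((t - x) * ((t - y) * (t - z))) := by grind
    simp [this, hd, sub_eq_zero]

theorem exists_projectiveRoots_eq_quadratic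
    (hF : ∀ p : Polynomial F, p.natDegree = 2 ∨ p.natDegree = 3 → ∃ x : F, p.IsRoot x)
    (hc : c ≠ 0) :
    ∃ x y : F, b = c * (x + y) ∧ a = c * (x * y) ∧
      projectiveRoots a b c 0 = {none, some x, some y} := by
  obtain ⟨x, hx⟩ := exists_quadratic_root hF b a hc
  have h1 : b = c * (x + (b / c + x)) := by grind
  generalize b / c + x = y at h1
  have h2 : a = c * (x * y) := by grind
  refine ⟨x, y, h1, h2, ?_⟩
  ext o
  cases o with
  | none => simp
  | some t =>
    have : a + b * t + c * t ^ 2 + 0 * t ^ 3 = c * ((t - x) * (t - y)) := by grind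
    simp only [some_mem_projectiveRoots, this]
    simp [hc, sub_eq_zero]

/-- For roots x, y, z one has ad + bc = d²(x+y)(y+z)(x+z), which detects a repeated root, and bd +
c² = d²(x²+y²+z²+xy+xz+yz), which becomes d²(x+z)² when x = y and so detects a triple one. When bd +
c² = 0, the quantity c³ + ad² equals d(ad + bc). For d = 0 the point (0 : 1) is itself a zero. -/
theorem encard_projectiveRoots_eq_one
    (hF : ∀ p : Polynomial F, p.natDegree = 2 ∨ p.natDegree = 3 → ∃ x : F, p.IsRoot x)
    (h : (d ≠ 0 ∧ b * d + c ^ 2 = 0 ∧ c ^ 3 + a * d ^ 2 = 0) ∨ (d = 0 ∧ c = 0 ∧ b = 0 ∧ a ≠ 0)) :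
    (projectiveRoots a b c d).encard = 1 := by
  obtain ⟨hd, h1, h2⟩ | ⟨rfl, rfl, rfl, ha⟩ := h
  · obtain ⟨x, y, z, rfl, rfl, rfl, h⟩ :=
      exists_projectiveRoots_eq_cubic (a := a) (b := b) (c := c) hF hd
    have e1 : y ^ 2 + y * z + z ^ 2 + x ^ 2 + x * y + x * z = 0 := by
      apply mul_left_cancel₀ (pow_ne_zero 2 hd); grind
    have e2 : (x + y) * (y + z) * (x + z) = 0 := by
      apply mul_left_cancel₀ (pow_ne_zero 3 hd); grind
    have e3 : x = y ∧ x = z := by grind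
    rw [h, ← e3.1, ← e3.2]
    simp
  · rw [projectiveRoots_eq_singleton ha, Set.encard_singleton]

theorem encard_projectiveRoots_eq_two
    (hF : ∀ p : Polynomial F, p.natDegree = 2 ∨ p.natDegree = 3 → ∃ x : F, p.IsRoot x)
    (h : (d ≠ 0 ∧ a * d + b * c = 0 ∧ d * b + c ^ 2 ≠ 0) ∨ (d = 0 ∧ c = 0 ∧ b ≠ 0) ∨
      (d = 0 ∧ c ≠ 0 ∧ b = 0)) :
    (projectiveRoots a b c d).encard = 2 := by
  obtain ⟨hd, h1, h2⟩ | ⟨rfl, rfl, hb⟩ | ⟨rfl, hc, hb⟩ := h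
  · obtain ⟨x, y, z, rfl, rfl, rfl, h⟩ :=
      exists_projectiveRoots_eq_cubic (a := a) (b := b) (c := c) hF hd
    have e2 : (x + y) * (y + z) * (x + z) = 0 := by
      apply mul_left_cancel₀ (pow_ne_zero 2 hd); grind
    rw [h]
    have e3 : (x = y ∧ x ≠ z) ∨ (x = z ∧ x ≠ y) ∨ (y = z ∧ x ≠ y) := by grind
    obtain ⟨rfl, hne⟩ | ⟨rfl, hne⟩ | ⟨rfl, hne⟩ := e3
    · rw [Set.insert_eq_of_mem (by simp), Set.encard_pair (by simpa using hne)]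
    · rw [Set.insert_eq_of_mem (by simp), Set.encard_pair (by simpa using hne.symm)]
    · rw [Set.pair_eq_singleton, Set.encard_pair (by simpa using hne)]
  · obtain ⟨x, h⟩ := exists_projectiveRoots_eq_linear (a := a) hb
    rw [h, Set.encard_pair (by simp)]
  · obtain ⟨x, y, h1, h2, h⟩ := exists_projectiveRoots_eq_quadratic (a := a) (b := b) hF hc
    have : x = y := by grind
    rw [h, this, Set.pair_eq_singleton, Set.encard_pair (by simp)]

theorem encard_projectiveRoots_eq_three
    (hF : ∀ p : Polynomial F, p.natDegree = 2 ∨ p.natDegree = 3 → ∃ x : F, p.IsRoot x)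
    (h : (d ≠ 0 ∧ a * d + b * c ≠ 0) ∨ (d = 0 ∧ c ≠ 0 ∧ b ≠ 0)) :
    (projectiveRoots a b c d).encard = 3 := by
  obtain ⟨hd, h1⟩ | ⟨rfl, hc, hb⟩ := h
  · obtain ⟨x, y, z, rfl, rfl, rfl, h⟩ :=
      exists_projectiveRoots_eq_cubic (a := a) (b := b) (c := c) hF hd
    rw [h, Set.encard_eq_three]
    exact ⟨some x, some y, some z, by grind, by grind, by grind, rfl⟩
  · obtain ⟨x, y, h1, h2, h⟩ := exists_projectiveRoots_eq_quadratic (a := a) (b := b) hF hc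
    rw [h, Set.encard_eq_three]
    exact ⟨none, some x, some y, by simp, by simp, by grind, rfl⟩

theorem infinite_projectiveRoots_zero
    (hF : ∀ p : Polynomial F, p.natDegree = 2 ∨ p.natDegree = 3 → ∃ x : F, p.IsRoot x)
    : (projectiveRoots (0 : F) 0 0 0).Infinite := by
  have := infinite_of_exists_root hF
  have : projectiveRoots (0 : F) 0 0 0 = Set.univ := by
    ext o
    cases o <;> simp
  rw [this]
  exact Set.infinite_univ

end Factor

end Counting

/-! ### Counts for the canonical algebras -/

section Canonical

variable {F : Type u} [Field F] [CharP F 2]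

namespace Canonical2

theorem inList_cases (c : Canonical2 F) : c.InList1 ∨ c.InList2 ∨ c.InList3 ∨ c.InListInf := by
  cases c <;> simp only [InList1, InList2, InList3, InListInf] <;> grind

theorem encard_eq_one
    (hF : ∀ p : Polynomial F, p.natDegree = 2 ∨ p.natDegree = 3 → ∃ x : F, p.IsRoot x)
    {c : Canonical2 F} (h : c.InList1) : (nontrivialSubalgebras F c.Alg).encard = 1 := by
  rw [MSCAlgebra.encard_nontrivialSubalgebras]
  apply encard_projectiveRoots_eq_one hF
  cases c <;> simp only [InList1, msc, matrix24_apply_00, matrix24_apply_01, matrix24_apply_02,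
    matrix24_apply_03, matrix24_apply_10, matrix24_apply_11, matrix24_apply_12,
    matrix24_apply_13] at h ⊢ <;>
    grind

theorem encard_eq_two
    (hF : ∀ p : Polynomial F, p.natDegree = 2 ∨ p.natDegree = 3 → ∃ x : F, p.IsRoot x)
    {c : Canonical2 F} (h : c.InList2) : (nontrivialSubalgebras F c.Alg).encard = 2 := by
  rw [MSCAlgebra.encard_nontrivialSubalgebras]
  apply encard_projectiveRoots_eq_two hF
  cases c <;> simp only [InList2, msc, matrix24_apply_00, matrix24_apply_01, matrix24_apply_02,
    matrix24_apply_03, matrix24_apply_10, matrix24_apply_11, matrix24_apply_12,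
    matrix24_apply_13] at h ⊢ <;>
    grind

theorem encard_eq_three
    (hF : ∀ p : Polynomial F, p.natDegree = 2 ∨ p.natDegree = 3 → ∃ x : F, p.IsRoot x)
    {c : Canonical2 F} (h : c.InList3) : (nontrivialSubalgebras F c.Alg).encard = 3 := by
  rw [MSCAlgebra.encard_nontrivialSubalgebras]
  apply encard_projectiveRoots_eq_three hF
  cases c <;> simp only [InList3, msc, matrix24_apply_00, matrix24_apply_01, matrix24_apply_02,
    matrix24_apply_03, matrix24_apply_10, matrix24_apply_11, matrix24_apply_12,
    matrix24_apply_13] at h ⊢ <;>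
    grind

theorem encard_eq_top
    (hF : ∀ p : Polynomial F, p.natDegree = 2 ∨ p.natDegree = 3 → ∃ x : F, p.IsRoot x)
    {c : Canonical2 F} (h : c.InListInf) : (nontrivialSubalgebras F c.Alg).encard = ⊤ := by
  rw [MSCAlgebra.encard_nontrivialSubalgebras, Set.encard_eq_top_iff]
  convert infinite_projectiveRoots_zero hF <;> cases c <;>
    simp only [InListInf, msc, matrix24_apply_00, matrix24_apply_01, matrix24_apply_02,
    matrix24_apply_03, matrix24_apply_10, matrix24_apply_11, matrix24_apply_12,
    matrix24_apply_13] at h ⊢ <;>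
    grind

theorem count_iff
    (hF : ∀ p : Polynomial F, p.natDegree = 2 ∨ p.natDegree = 3 → ∃ x : F, p.IsRoot x)
    (c : Canonical2 F) :
    ((nontrivialSubalgebras F c.Alg).encard = 1 ↔ c.InList1) ∧
      ((nontrivialSubalgebras F c.Alg).encard = 2 ↔ c.InList2) ∧
      ((nontrivialSubalgebras F c.Alg).encard = 3 ↔ c.InList3) ∧
      ((nontrivialSubalgebras F c.Alg).Infinite ↔ c.InListInf) := by
  have h1 := encard_eq_one hF (c := c)
  have h2 := encard_eq_two hF (c := c)
  have h3 := encard_eq_three hF (c := c)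
  have h4 := encard_eq_top hF (c := c)
  have n12 : (1 : ℕ∞) ≠ 2 := by decide
  have n13 : (1 : ℕ∞) ≠ 3 := by decide
  have n23 : (2 : ℕ∞) ≠ 3 := by decide
  have n1 : (1 : ℕ∞) ≠ ⊤ := by decide
  have n2 : (2 : ℕ∞) ≠ ⊤ := by decide
  have n3 : (3 : ℕ∞) ≠ ⊤ := by decide
  rw [← Set.encard_eq_top_iff]
  generalize (nontrivialSubalgebras F c.Alg).encard = n at *
  -- Each list forces its count, the lists cover all cases and the four counts differ; hence each
  -- count forces its list.
  have := inList_cases c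
  refine ⟨⟨fun h => ?_, h1⟩, ⟨fun h => ?_, h2⟩, ⟨fun h => ?_, h3⟩, ⟨fun h => ?_, h4⟩⟩ <;>
    subst h <;> simp_all

end Canonical2

end Canonical

/-! ### Transfer along isomorphisms and the classification -/

theorem encard_nontrivialSubalgebras_congr {F : Type u} [Field F] {A : Type v} {B : Type u}
    [NonUnitalNonAssocRing A] [Module F A] [NonUnitalNonAssocRing B] [Module F B]
    (h : AlgIsomorphic F A B) :
    (nontrivialSubalgebras F A).encard = (nontrivialSubalgebras F B).encard := by
  obtain ⟨e, he⟩ := h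
  let f : A →ₙₐ[F] B := { e with map_mul' := he, map_zero' := e.map_zero }
  have hf : Function.Injective f := e.injective
  have key : NonUnitalSubalgebra.map f '' nontrivialSubalgebras F A =
      nontrivialSubalgebras F B := by
    ext S
    constructor
    · rintro ⟨T, hT, rfl⟩
      exact (LinearEquiv.finrank_map_eq e T.toSubmodule).trans hT
    · intro hS
      have hmap : (S.comap f).map f = S := by
        ext x
        simp only [NonUnitalSubalgebra.mem_map, NonUnitalSubalgebra.mem_comap]
        exact ⟨fun ⟨y, hy, hyx⟩ => hyx ▸ hy, fun hx => ⟨e.symm x,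
          (e.apply_symm_apply x).symm ▸ hx, e.apply_symm_apply x⟩⟩
      refine ⟨S.comap f, ?_, hmap⟩
      refine (LinearEquiv.finrank_map_eq e (S.comap f).toSubmodule).symm.trans ?_
      have : ((S.comap f).map f).toSubmodule = S.toSubmodule := by rw [hmap]
      exact (congrArg (fun W : Submodule F B => Module.finrank F W) this).trans hS
  rw [← key, (NonUnitalSubalgebra.map_injective hf).encard_image]

theorem existsUnique_canonical {F : Type u} [Field F] [CharP F 2]
    (hF : ∀ p : Polynomial F, p.natDegree = 2 ∨ p.natDegree = 3 → ∃ x : F, p.IsRoot x)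
    (A : Type v) [NonUnitalNonAssocRing A] [Module F A] [IsScalarTower F A A]
    [SMulCommClass F A A] (hdim : Module.finrank F A = 2) (hA : ∃ x y : A, x * y ≠ 0) :
    ∃! c : Canonical2 F, AlgIsomorphic F A c.Alg := by
  have := Module.finite_of_finrank_pos (R := F) (M := A) (by omega)
  have b := Module.finBasisOfFinrankEq F A hdim
  obtain ⟨M, hM⟩ := exists_isStructureMatrix b
  obtain ⟨c, hc⟩ := HasStructureMatrix.exists_canonical hF hA ⟨b, hM⟩
  refine ⟨c, (algIsomorphic_iff _).2 hc, fun c' hc' => ?_⟩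
  obtain ⟨b₁, h₁⟩ := (algIsomorphic_iff _).1 hc'
  obtain ⟨b₂, h₂⟩ := hc
  -- Two canonical matrices of the same algebra differ by a base change, hence coincide.
  obtain ⟨p, q, r, s, h⟩ := h₁.exists_baseChange h₂
  exact Canonical2.eq_of_baseChange h

theorem theorem3p2 {F : Type u} [Field F] [CharP F 2]
    (hF : ∀ p : Polynomial F, p.natDegree = 2 ∨ p.natDegree = 3 → ∃ x : F, p.IsRoot x) :
    -- the number of nontrivial subalgebras of each canonical algebra
    (∀ c : Canonical2 F,
      ((nontrivialSubalgebras F c.Alg).encard = 1 ↔ c.InList1) ∧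
      ((nontrivialSubalgebras F c.Alg).encard = 2 ↔ c.InList2) ∧
      ((nontrivialSubalgebras F c.Alg).encard = 3 ↔ c.InList3) ∧
      ((nontrivialSubalgebras F c.Alg).Infinite ↔ c.InListInf)) ∧
    -- classification of the two-dimensional algebras with nonzero product
    (∀ (A : Type v) [NonUnitalNonAssocRing A] [Module F A] [IsScalarTower F A A]
        [SMulCommClass F A A], Module.finrank F A = 2 → (∃ x y : A, x * y ≠ 0) →
      ((nontrivialSubalgebras F A).encard = 1 →
        ∃! c : Canonical2 F, c.InList1 ∧ AlgIsomorphic F A c.Alg) ∧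
      ((nontrivialSubalgebras F A).encard = 2 →
        ∃! c : Canonical2 F, c.InList2 ∧ AlgIsomorphic F A c.Alg) ∧
      ((nontrivialSubalgebras F A).encard = 3 →
        ∃! c : Canonical2 F, c.InList3 ∧ AlgIsomorphic F A c.Alg) ∧
      ((nontrivialSubalgebras F A).Infinite →
        ∃! c : Canonical2 F, c.InListInf ∧ AlgIsomorphic F A c.Alg)) := by
  refine ⟨Canonical2.count_iff hF, fun A _ _ _ _ hdim hA => ?_⟩
  obtain ⟨c, hc, huniq⟩ := existsUnique_canonical hF A hdim hA
  have hcount := encard_nontrivialSubalgebras_congr hc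
  obtain ⟨h1, h2, h3, h4⟩ := Canonical2.count_iff hF c
  refine ⟨fun h => ⟨c, ⟨h1.1 (hcount ▸ h), hc⟩, fun c' h' => huniq c' h'.2⟩,
    fun h => ⟨c, ⟨h2.1 (hcount ▸ h), hc⟩, fun c' h' => huniq c' h'.2⟩,
    fun h => ⟨c, ⟨h3.1 (hcount ▸ h), hc⟩, fun c' h' => huniq c' h'.2⟩,
    fun h => ⟨c, ⟨h4.1 ?_, hc⟩, fun c' h' => huniq c' h'.2⟩⟩
  rw [← Set.encard_eq_top_iff] at h ⊢
  rw [← hcount, h]
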